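/- Identify a set-valued operator $A:\mathbb{R}^n\rightrightarrows\mathbb{R}^n$ with its graph in $\mathbb{R}^n\times\mathbb{R}^n$. It is a linear relation if its graph is a linear subspace; it is symmetric if $\langle x,y^*\rangle=\langle y,x^*\rangle$ for all $(x,x^*),(y,y^*)\in A$; it is monotone if $\langle x^*-y^*,x-y\rangle\ge 0$ for all $(x,x^*),(y,y^*)\in A$, and maximally monotone if moreover no monotone operator properly contains it. For a monotone linear relation $A$ put $q_A(x)=\frac12\langle x,Ax\rangle$ if $x\in\operatorname{dom}A$ (the value $\langle x,x^*\rangle$ is the same for all $x^*\in Ax$) and $q_A(x)=\infty$ otherwise. Let $\Gamma_0(\mathbb{R}^n)$ be the set of proper convex lower semicontinuous functions $\mathbb{R}^n\to\mathbb{R}\cup\{\infty\}$ and let $$U=\{f\in\Gamma_0(\mathbb{R}^n): f=q_A+c,\ A\text{ a maximally monotone symmetric linear relation on }\mathbb{R}^n,\ c\in\mathbb{R}\}.$$ For $r>0$ let $e_rf(x)=\inf_{y}\{f(y)+\frac r2\|y-x\|^2\}$ be the Moreau envelope of $f$, and let $$d(f,g)=\sum_{i=1}^\infty\frac1{2^i}\,\frac{\sup_{\|x\|\le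 i}|e_rf(x)-e_rg(x)|}{1+\sup_{\|x\|\le i}|e_rf(x)-e_rg(x)|}$$ be the Attouch–Wets metric. Then the following hold. (i) For every $r>0$, the suprema of $|e_rf-e_rg|$ over bounded balls are finite for $f,g\in U$, and $(U,d)$ is a complete metric space. (ii) If $f\in U$, then its Fenchel conjugate $f^*(y)=\sup_x[\langle y,x\rangle-f(x)]$ belongs to $U$. (iii) If $f\in U$ and $\lambda>0$, then $\lambda f\in U$. (iv) If $f_1,f_2\in U$, then $f_1+f_2\in U$. (v) If $f_1,f_2\in U$, then the infimal convolution $f_1\,\square\,f_2\,(x)=\inf_y[f_1(y)+f_2(x-y)]$ belongs to $U$. -/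

import Mathlib

open scoped ENNReal

noncomputable section

namespace GenLinQuad

/-- The Euclidean space `ℝⁿ`. -/
abbrev E (n : ℕ) : Type := EuclideanSpace ℝ (Fin n)

/-! ### Extended-real-valued functions. Functions `ℝⁿ → ℝ ∪ {∞}` are functions into `EReal`;
properness excludes the value `-∞`. -/

/-- `f` is proper: it never takes the value `-∞` and is finite somewhere. -/
def Proper {n : ℕ} (f : E n → EReal) : Prop :=
  (∀ x, f x ≠ ⊥) ∧ ∃ x, f x ≠ ⊤

/-- The epigraph of `f`, a subset of `ℝⁿ × ℝ`. -/
def epi {n : ℕ} (f : E n → EReal) : Set (E n × ℝ) :=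
  {p | f p.1 ≤ (p.2 : EReal)}

/-- `Γ₀(ℝⁿ)`: the proper, convex, lower semicontinuous functions. -/
def Gamma0 (n : ℕ) : Set (E n → EReal) :=
  {f | Proper f ∧ Convex ℝ (epi f) ∧ LowerSemicontinuous f}

/-- The Fenchel conjugate `f*(y) = sup_x [⟨y, x⟩ - f x]`. -/
def fenchelConj {n : ℕ} (f : E n → EReal) : E n → EReal :=
  fun y => ⨆ x, ((inner ℝ y x : ℝ) : EReal) - f x

/-- The infimal convolution `(f □ g)(x) = inf_y [f y + g (x - y)]`. -/
def infConv {n : ℕ} (f g : E n → EReal) : E n → EReal :=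
  fun x => ⨅ y, f y + g (x - y)

/-- The Moreau envelope `e_r f (x) = inf_y [f y + (r / 2) ‖y - x‖²]`. -/
def moreauEnv {n : ℕ} (r : ℝ) (f : E n → EReal) : E n → EReal :=
  fun x => ⨅ y, f y + ((r / 2 * ‖y - x‖ ^ 2 : ℝ) : EReal)

/-- `sup_{‖x‖ ≤ ρ} |e_r f (x) - e_r g (x)|`, in `[0, ∞]`. It is `∞` as soon as one of the
envelopes is infinite at a point of the ball, because `|±∞| = ∞` and `∞ - ∞ = -∞` in `EReal`. -/
def envGap {n : ℕ} (r : ℝ) (f g : E n → EReal) (ρ : ℝ) : ℝ≥0∞ :=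
  ⨆ x ∈ Metric.closedBall (0 : E n) ρ, (moreauEnv r f x - moreauEnv r g x).abs

/-- The Attouch–Wets distance
`d(f, g) = ∑_{i ≥ 1} 2⁻ⁱ s_i / (1 + s_i)`, `s_i = sup_{‖x‖ ≤ i} |e_r f (x) - e_r g (x)|`
(the summation index below is `i - 1`). The series always converges; the `s_i` have to be finite
for the formula to be meaningful. -/
def attouchWetsDist {n : ℕ} (r : ℝ) (f g : E n → EReal) : ℝ :=
  ∑' k : ℕ, 1 / (2 : ℝ) ^ (k + 1) *
    ((envGap r f g ((k : ℝ) + 1)).toReal / (1 + (envGap r f g ((k : ℝ) + 1)).toReal))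

/-! ### Set-valued operators `ℝⁿ ⇉ ℝⁿ`, identified with their graphs. -/

/-- `A` is monotone: `⟨x* - y*, x - y⟩ ≥ 0` for all `(x, x*), (y, y*)` in its graph. -/
def IsMonotoneOp {n : ℕ} (A : Set (E n × E n)) : Prop :=
  ∀ p ∈ A, ∀ q ∈ A, 0 ≤ inner ℝ (p.2 - q.2) (p.1 - q.1)

/-- `A` is maximally monotone: it is monotone and no monotone operator contains it properly. -/
def IsMaxMonotoneOp {n : ℕ} (A : Set (E n × E n)) : Prop :=
  Maximal IsMonotoneOp A

/-- `A` is a linear relation: its graph is a linear subspace of `ℝⁿ × ℝⁿ`. -/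
def IsLinearRel {n : ℕ} (A : Set (E n × E n)) : Prop :=
  ∃ S : Submodule ℝ (E n × E n), (S : Set (E n × E n)) = A

/-- The graph of the adjoint of `A`: the `(y, y*)` with `⟨a, y*⟩ = ⟨a*, y⟩` for all
`(a, a*)` in the graph of `A`. -/
def adjointRel {n : ℕ} (A : Set (E n × E n)) : Set (E n × E n) :=
  {p | ∀ a ∈ A, (inner ℝ a.1 p.2 : ℝ) = inner ℝ a.2 p.1}

/-- `A` is symmetric: its graph is contained in the graph of its adjoint. -/
def IsSymmRel {n : ℕ} (A : Set (E n × E n)) : Prop :=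
  A ⊆ adjointRel A

open Classical in
/-- `q_A(x) = ½ ⟨x, A x⟩` if `x ∈ dom A`, and `∞` otherwise. The element of `A x` is picked
by choice; for a monotone linear relation the value does not depend on it, see `quadRel_eq`. -/
def quadRel {n : ℕ} (A : Set (E n × E n)) : E n → EReal :=
  fun x => if h : ∃ u, (x, u) ∈ A then ((1 / 2 * inner ℝ x h.choose : ℝ) : EReal) else ⊤

/-- For a monotone linear relation `⟨x, A x⟩` is single-valued on `dom A`. -/
theorem quadRel_eq {n : ℕ} {A : Set (E n × E n)} (hm : IsMonotoneOp A) (hl : IsLinearRel A)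
    {x u : E n} (hu : (x, u) ∈ A) : quadRel A x = ((1 / 2 * inner ℝ x u : ℝ) : EReal) := by
  obtain ⟨S, rfl⟩ := hl
  have key : ∀ v, (x, v) ∈ (S : Set (E n × E n)) → (inner ℝ x v : ℝ) = inner ℝ x u := by
    intro v hv
    have h : ∀ t : ℝ, 0 ≤ inner ℝ x u + t * (inner ℝ x v - inner ℝ x u) := by
      intro t
      have h1 : ((x, u) + t • ((x, v) - (x, u)) : E n × E n) ∈ S :=
        S.add_mem hu (S.smul_mem t (S.sub_mem hv hu))
      have h2 := hm _ h1 _ S.zero_mem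
      simp only [Prod.snd_add, Prod.smul_snd, Prod.snd_sub, Prod.fst_add, Prod.smul_fst,
        Prod.fst_sub, Prod.fst_zero, Prod.snd_zero, sub_zero, sub_self, smul_zero, add_zero] at h2
      rw [real_inner_comm, inner_add_right, inner_smul_right, inner_sub_right] at h2
      exact h2
    by_contra hne
    have hd : (inner ℝ x v : ℝ) - inner ℝ x u ≠ 0 := sub_ne_zero.mpr hne
    have h3 := h (-(inner ℝ x u + 1) / (inner ℝ x v - inner ℝ x u))
    rw [div_mul_cancel₀ _ hd] at h3
    linarith
  have hex : ∃ u, (x, u) ∈ (S : Set (E n × E n)) := ⟨u, hu⟩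
  simp only [quadRel, dif_pos hex, key _ hex.choose_spec]

/-- The class `U` of the functions `q_A + c` in `Γ₀(ℝⁿ)`, with `A` a maximally monotone
symmetric linear relation and `c` a real number. -/
def U (n : ℕ) : Set (E n → EReal) :=
  {f | f ∈ Gamma0 n ∧ ∃ (A : Set (E n × E n)) (c : ℝ),
    IsMaxMonotoneOp A ∧ IsSymmRel A ∧ IsLinearRel A ∧ f = fun x => quadRel A x + (c : EReal)}

end GenLinQuad

end

namespace GenLinQuad


/-! ### Symmetric monotone linear relations as submodules -/

/-! The algebraic closure properties come from operations on graphs: conjugation corresponds to the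
inverse relation, positive scaling to a multiple, addition to the sum, infimal convolution to the
parallel sum. For maximal `A`, `q_A` is a supremum of affine functions (`SymmMax.quadRel_eq_iSup`),
which puts `q_A + c` in `Γ₀`. Any symmetric monotone linear relation has a maximal extension with
the same domain and the same quadratic function (`relExt`), so maximality need not be checked by
hand to land in `U` (`SymmMono.mem_U`).

For completeness, fix `r`. The map `(a, b) ↦ a + r⁻¹ b` is a bijection from the graph of `A` onto
`ℝⁿ`, so `q_A + c` is coded by a pair `(M, c)` with envelope `½ ⟨x, M x⟩ + c` (`exists_eq_envFun`).
The admissible `M` are cut out by closed conditions (`isClosed_setOf_isEnvOp`). By polarization the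
gap on the ball of radius 2 bounds `‖M - N‖` and `|c - d|` (`norm_sub_le_envGap`,
`abs_sub_le_envGap`), and these two in turn bound the gap on every ball. Hence a `d`-Cauchy sequence
has Cauchy codes, whose limit codes the required limit in `U`. -/

/-- A submodule of `ℝⁿ × ℝⁿ` that is the graph of a symmetric monotone linear relation. -/
structure SymmMono {n : ℕ} (S : Submodule ℝ (E n × E n)) : Prop where
  nonneg : ∀ p ∈ S, 0 ≤ (inner ℝ p.1 p.2 : ℝ)
  symm : ∀ p ∈ S, ∀ q ∈ S, (inner ℝ p.1 q.2 : ℝ) = inner ℝ p.2 q.1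

/-- A submodule of `ℝⁿ × ℝⁿ` that is the graph of a maximally monotone symmetric linear
relation. -/
structure SymmMax {n : ℕ} (S : Submodule ℝ (E n × E n)) : Prop extends SymmMono S where
  max : ∀ p : E n × E n, (∀ q ∈ S, 0 ≤ (inner ℝ (p.2 - q.2) (p.1 - q.1) : ℝ)) → p ∈ S

variable {n : ℕ} {S T : Submodule ℝ (E n × E n)} {r ρ : ℝ}

theorem SymmMono.isMonotoneOp (h : SymmMono S) : IsMonotoneOp (S : Set (E n × E n)) := by
  intro p hp q hq
  rw [real_inner_comm]
  exact h.nonneg _ (S.sub_mem hp hq)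

theorem SymmMono.quadRel_of_mem (h : SymmMono S) {x u : E n} (hu : (x, u) ∈ S) :
    quadRel (S : Set (E n × E n)) x = ((1 / 2 * inner ℝ x u : ℝ) : EReal) :=
  quadRel_eq h.isMonotoneOp ⟨S, rfl⟩ hu

theorem quadRel_of_forall_notMem {A : Set (E n × E n)} {x : E n} (hx : ∀ u, (x, u) ∉ A) :
    quadRel A x = ⊤ := by
  have h : ¬ ∃ u, (x, u) ∈ A := fun ⟨u, hu⟩ => hx u hu
  simp only [quadRel, dif_neg h]

theorem symmMax_of_rel {A : Set (E n × E n)} (hm : IsMaxMonotoneOp A) (hs : IsSymmRel A)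
    (hl : IsLinearRel A) : ∃ S : Submodule ℝ (E n × E n), (S : Set (E n × E n)) = A ∧
      SymmMax S := by
  obtain ⟨S, rfl⟩ := hl
  refine ⟨S, rfl, ⟨fun p hp => ?_, fun p hp q hq => ?_⟩, fun p hp => ?_⟩
  · have := hm.prop p hp 0 S.zero_mem
    rw [real_inner_comm]
    simpa using this
  · exact hs hq p hp
  · have : IsMonotoneOp (insert p (S : Set (E n × E n))) := by
      rintro a (rfl | ha) b (rfl | hb)
      · simp
      · exact hp b hb
      · have := hp a ha
        rw [← neg_sub, ← neg_sub b.1, inner_neg_neg]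
        exact this
      · exact hm.prop a ha b hb
    exact hm.le_of_ge this (Set.subset_insert _ _) (Set.mem_insert _ _)

theorem SymmMax.isMaxMonotoneOp (h : SymmMax S) : IsMaxMonotoneOp (S : Set (E n × E n)) :=
  ⟨h.isMonotoneOp, fun _ hB hSB p hp => h.max p fun q hq => hB p hp q (hSB hq)⟩

/-- A real that stays nonnegative after adding any multiple of `b` forces `b = 0`. -/
theorem eq_zero_of_forall_add_mul_nonneg {a b : ℝ} (h : ∀ t : ℝ, 0 ≤ a + t * b) : b = 0 := by
  by_contra hb
  have := h (-(a + 1) / b)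
  rw [div_mul_cancel₀ _ hb] at this
  linarith

/-- The domain of a linear relation. -/
abbrev relDom (S : Submodule ℝ (E n × E n)) : Submodule ℝ (E n) :=
  S.map (LinearMap.fst ℝ (E n) (E n))

theorem mem_relDom {x : E n} : x ∈ relDom S ↔ ∃ u, (x, u) ∈ S := by
  simp [relDom]

theorem mem_of_forall_orthogonal (D : Submodule ℝ (E n)) {x : E n}
    (h : ∀ v ∈ Dᗮ, (inner ℝ v x : ℝ) = 0) : x ∈ D := by
  rw [← D.orthogonal_orthogonal]
  exact (Submodule.mem_orthogonal _ _).2 h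

/-- Testing `(0, v)` against `q ∈ S` leaves only `⟨q.1, q.2⟩ ≥ 0`, since `v ⊥ q.1`; maximality does
the rest. -/
theorem SymmMax.zero_prod_mem (h : SymmMax S) {v : E n} (hv : v ∈ (relDom S)ᗮ) :
    ((0, v) : E n × E n) ∈ S := by
  refine h.max _ fun q hq => ?_
  have h1 : (inner ℝ q.1 v : ℝ) = 0 :=
    (Submodule.mem_orthogonal _ _).1 hv _ (mem_relDom.2 ⟨q.2, hq⟩)
  have h2 := h.nonneg q hq
  simp only [zero_sub, inner_neg_right, inner_sub_left]
  rw [real_inner_comm, h1, real_inner_comm]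
  linarith

/-- `q_A` is the supremum of the affine functions `x ↦ ⟨b, x⟩ - ½ ⟨a, b⟩`, `(a, b) ∈ A`. -/
theorem SymmMax.quadRel_eq_iSup (h : SymmMax S) (x : E n) :
    quadRel (S : Set (E n × E n)) x =
      ⨆ p : S, ((inner ℝ p.1.2 x - 1 / 2 * inner ℝ p.1.1 p.1.2 : ℝ) : EReal) := by
  by_cases hx : ∃ u, (x, u) ∈ S
  · obtain ⟨u, hu⟩ := hx
    rw [h.quadRel_of_mem hu]
    apply le_antisymm
    · refine le_iSup_of_le (⟨(x, u), hu⟩ : S) (EReal.coe_le_coe_iff.2 ?_)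
      simp only
      rw [real_inner_comm x u]
      linarith
    · refine iSup_le fun p => EReal.coe_le_coe_iff.2 ?_
      have h1 := h.nonneg _ (S.sub_mem hu p.2)
      have h2 := h.symm _ hu _ p.2
      simp only [Prod.fst_sub, Prod.snd_sub, inner_sub_left, inner_sub_right] at h1 h2
      rw [real_inner_comm x p.1.2]
      rw [real_inner_comm p.1.1 u] at h2
      linarith
  · push Not at hx
    rw [quadRel_of_forall_notMem hx]
    symm
    rw [EReal.eq_top_iff_forall_lt]
    intro y
    -- Off the domain some `v ⊥ dom` sees `x`; the pairs `(0, t v)` in `S` give affine functions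
    -- with value `t ⟨v, x⟩`, which is unbounded in `t`.
    obtain ⟨v, hv, hvx⟩ : ∃ v ∈ (relDom S)ᗮ, (inner ℝ v x : ℝ) ≠ 0 := by
      by_contra! hc
      obtain ⟨u, hu⟩ := mem_relDom.1 (mem_of_forall_orthogonal _ hc)
      exact hx u hu
    have h1 := S.smul_mem ((y + 1) / inner ℝ v x) (h.zero_prod_mem hv)
    refine lt_of_lt_of_le (b := ((y + 1 : ℝ) : EReal)) (EReal.coe_lt_coe_iff.2 (by linarith))
      (le_iSup_of_le (⟨_, h1⟩ : S) (EReal.coe_le_coe_iff.2 ?_))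
    simp only [Prod.smul_mk, smul_zero, inner_zero_left, mul_zero, sub_zero, real_inner_smul_left]
    rw [div_mul_cancel₀ _ hvx]

theorem SymmMax.affine_le_quadRel (h : SymmMax S) {p : E n × E n} (hp : p ∈ S) (x : E n) :
    ((inner ℝ p.2 x - 1 / 2 * inner ℝ p.1 p.2 : ℝ) : EReal) ≤
      quadRel (S : Set (E n × E n)) x := by
  rw [h.quadRel_eq_iSup]
  exact le_iSup (fun p : S => ((inner ℝ p.1.2 x - 1 / 2 * inner ℝ p.1.1 p.1.2 : ℝ) : EReal))
    ⟨p, hp⟩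

theorem SymmMono.quadRel_ne_bot (h : SymmMono S) (x : E n) :
    quadRel (S : Set (E n × E n)) x ≠ ⊥ := by
  by_cases hx : ∃ u, (x, u) ∈ S
  · obtain ⟨u, hu⟩ := hx
    rw [h.quadRel_of_mem hu]
    exact EReal.coe_ne_bot _
  · push Not at hx
    rw [quadRel_of_forall_notMem hx]
    exact top_ne_bot

theorem SymmMax.quadRel_add_eq_iSup (h : SymmMax S) (c : ℝ) (x : E n) :
    quadRel (S : Set (E n × E n)) x + (c : EReal) =
      ⨆ p : S, ((inner ℝ p.1.2 x - 1 / 2 * inner ℝ p.1.1 p.1.2 + c : ℝ) : EReal) := by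
  apply le_antisymm
  · rw [← EReal.le_sub_iff_add_le (Or.inl (EReal.coe_ne_bot _)) (Or.inl (EReal.coe_ne_top _)),
      h.quadRel_eq_iSup]
    refine iSup_le fun p => ?_
    rw [EReal.le_sub_iff_add_le (Or.inl (EReal.coe_ne_bot _)) (Or.inl (EReal.coe_ne_top _)),
      ← EReal.coe_add]
    exact le_iSup (fun p : S =>
      ((inner ℝ p.1.2 x - 1 / 2 * inner ℝ p.1.1 p.1.2 + c : ℝ) : EReal)) p
  · refine iSup_le fun p => ?_
    rw [EReal.coe_add]
    gcongr
    exact h.affine_le_quadRel p.2 x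

theorem SymmMax.mem_U (h : SymmMax S) (c : ℝ) :
    (fun x => quadRel (S : Set (E n × E n)) x + (c : EReal)) ∈ U n := by
  refine ⟨⟨⟨fun x => ?_, 0, ?_⟩, ?_, ?_⟩, S, c, h.isMaxMonotoneOp, fun q hq p hp => h.symm p hp q hq,
    ⟨S, rfl⟩, rfl⟩
  · simp [EReal.add_eq_bot_iff, h.quadRel_ne_bot x]
  · simp only [h.quadRel_of_mem S.zero_mem, ← EReal.coe_add]
    exact EReal.coe_ne_top _
  -- The epigraph of a supremum of affine functions is an intersection of half-spaces.
  · have : epi (fun x => quadRel (S : Set (E n × E n)) x + (c : EReal)) =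
        ⋂ p : S, {z : E n × ℝ | inner ℝ p.1.2 z.1 - 1 / 2 * inner ℝ p.1.1 p.1.2 + c ≤ z.2} := by
      ext z
      simp only [epi, h.quadRel_add_eq_iSup c, Set.mem_ofPred_eq, iSup_le_iff, EReal.coe_le_coe_iff, Set.mem_iInter]
    rw [this]
    refine convex_iInter fun p x hx y hy a b ha hb hab => ?_
    simp only [Set.mem_ofPred_eq, Prod.fst_add, Prod.snd_add, Prod.smul_fst, Prod.smul_snd,
      inner_add_right, real_inner_smul_right, smul_eq_mul] at hx hy ⊢
    obtain rfl : b = 1 - a := by linarith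
    nlinarith [mul_le_mul_of_nonneg_left hx ha, mul_le_mul_of_nonneg_left hy hb]
  · rw [show (fun x => quadRel (S : Set (E n × E n)) x + (c : EReal)) = _ from
      funext (h.quadRel_add_eq_iSup c)]
    refine lowerSemicontinuous_iSup fun p => Continuous.lowerSemicontinuous ?_
    exact continuous_coe_real_ereal.comp (by fun_prop)

theorem mem_U_iff {f : E n → EReal} : f ∈ U n ↔ ∃ (S : Submodule ℝ (E n × E n)) (c : ℝ),
    SymmMax S ∧ f = fun x => quadRel (S : Set (E n × E n)) x + (c : EReal) := by
  constructor
  · rintro ⟨-, A, c, hm, hs, hl, rfl⟩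
    obtain ⟨S, rfl, hS⟩ := symmMax_of_rel hm hs hl
    exact ⟨S, c, hS, rfl⟩
  · rintro ⟨S, c, hS, rfl⟩
    exact hS.mem_U c

/-- The maximally monotone extension of a symmetric monotone linear relation with the same
domain. -/
def relExt (S : Submodule ℝ (E n × E n)) : Submodule ℝ (E n × E n) where
  carrier := {p | p.1 ∈ relDom S ∧ ∀ a ∈ S, (inner ℝ a.1 p.2 : ℝ) = inner ℝ a.2 p.1}
  add_mem' := fun hp hq => ⟨Submodule.add_mem _ hp.1 hq.1, fun a ha => by
    simp [inner_add_right, hp.2 a ha, hq.2 a ha]⟩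
  zero_mem' := ⟨Submodule.zero_mem _, fun a _ => by simp⟩
  smul_mem' := fun c p hp => ⟨Submodule.smul_mem _ _ hp.1, fun a ha => by
    simp [real_inner_smul_right, hp.2 a ha]⟩

theorem SymmMono.le_relExt (h : SymmMono S) : S ≤ relExt S :=
  fun p hp => ⟨mem_relDom.2 ⟨p.2, hp⟩, fun a ha => h.symm a ha p hp⟩

theorem SymmMono.symmMono_relExt (h : SymmMono S) : SymmMono (relExt S) := by
  refine ⟨?_, ?_⟩
  · rintro ⟨x, u⟩ ⟨hx, hu⟩
    obtain ⟨v, hv⟩ := mem_relDom.1 hx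
    have h1 := hu _ hv
    have h2 := h.nonneg _ hv
    simp only at h1 h2 ⊢
    rw [h1, real_inner_comm]
    exact h2
  · rintro ⟨x, u⟩ ⟨hx, hu⟩ ⟨y, w⟩ ⟨hy, hw⟩
    obtain ⟨u', hu'⟩ := mem_relDom.1 hx
    obtain ⟨w', hw'⟩ := mem_relDom.1 hy
    have h1 := hu _ hw'
    have h2 := hw _ hu'
    have h3 := h.symm _ hu' _ hw'
    simp only at h1 h2 h3 ⊢
    rw [h2, ← h3, real_inner_comm y u, h1, real_inner_comm]

/-- Let `p` be monotonically related to the extension. Testing against `(0, v)` with `v ⊥ dom` puts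
`p.1` in the domain. For `(p.1, w) ∈ S`, testing against small perturbations of it inside `S` forces
`p.2 - w ⊥ dom`. -/
theorem SymmMono.symmMax_relExt (h : SymmMono S) : SymmMax (relExt S) := by
  refine ⟨h.symmMono_relExt, fun p hp => ?_⟩
  have hdom : p.1 ∈ relDom S := by
    refine mem_of_forall_orthogonal _ fun v hv => ?_
    refine eq_zero_of_forall_add_mul_nonneg (a := inner ℝ p.2 p.1) fun t => ?_
    have hm : ((0, (-t) • v) : E n × E n) ∈ relExt S := by
      refine ⟨Submodule.zero_mem _, fun a ha => ?_⟩
      have := (Submodule.mem_orthogonal _ _).1 hv a.1 (mem_relDom.2 ⟨a.2, ha⟩)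
      simp [real_inner_smul_right, this]
    have := hp _ hm
    simpa [inner_add_left, real_inner_smul_left] using this
  refine ⟨hdom, fun a ha => ?_⟩
  obtain ⟨w, hw⟩ := mem_relDom.1 hdom
  have h0 : (inner ℝ a.1 (p.2 - w) : ℝ) = 0 := by
    refine eq_zero_of_forall_add_mul_nonneg (a := 0) fun t => ?_
    rw [zero_add]
    -- The perturbation is `-(s t) a`; the monotonicity inequality is divided by `s > 0`, and `s →
    -- 0⁺` kills the quadratic term.
    refine ge_of_tendsto (f := fun s : ℝ => t * inner ℝ a.1 (p.2 - w) +
      s * (t ^ 2 * inner ℝ a.1 a.2)) (x := nhdsWithin 0 (Set.Ioi 0)) ?_ ?_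
    · have : Filter.Tendsto (fun s : ℝ => t * (inner ℝ a.1 (p.2 - w) : ℝ) +
          s * (t ^ 2 * inner ℝ a.1 a.2)) (nhds 0) (nhds (t * inner ℝ a.1 (p.2 - w) +
          0 * (t ^ 2 * inner ℝ a.1 a.2))) := by
        apply Continuous.tendsto
        fun_prop
      simpa using this.mono_left nhdsWithin_le_nhds
    · filter_upwards [self_mem_nhdsWithin] with s hs
      have hs : 0 < s := hs
      have := hp _ (h.le_relExt (S.add_mem hw (S.smul_mem (-(s * t)) ha)))
      have h4 : (inner ℝ (p.2 - (w + (-(s * t)) • a.2)) (p.1 - (p.1 + (-(s * t)) • a.1)) : ℝ) =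
          s * (t * inner ℝ a.1 (p.2 - w) + s * (t ^ 2 * inner ℝ a.1 a.2)) := by
        rw [show p.1 - (p.1 + (-(s * t)) • a.1) = (s * t) • a.1 by module,
          show p.2 - (w + (-(s * t)) • a.2) = (p.2 - w) + (s * t) • a.2 by module,
          real_inner_comm, real_inner_smul_left, inner_add_right, real_inner_smul_right]
        ring
      exact nonneg_of_mul_nonneg_right (h4 ▸ this) hs
  have h5 := h.symm _ ha _ hw
  simp only at h5
  rw [inner_sub_right, h5] at h0
  linarith

theorem SymmMono.quadRel_relExt (h : SymmMono S) :
    quadRel (relExt S : Set (E n × E n)) = quadRel (S : Set (E n × E n)) := by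
  funext x
  by_cases hx : ∃ u, (x, u) ∈ S
  · obtain ⟨u, hu⟩ := hx
    rw [h.quadRel_of_mem hu, h.symmMono_relExt.quadRel_of_mem (h.le_relExt hu)]
  · rw [quadRel_of_forall_notMem (A := (S : Set (E n × E n))) fun u hu => hx ⟨u, hu⟩,
      quadRel_of_forall_notMem fun u hu => hx (mem_relDom.1 hu.1)]

theorem SymmMono.mem_U (h : SymmMono S) (c : ℝ) :
    (fun x => quadRel (S : Set (E n × E n)) x + (c : EReal)) ∈ U n := by
  rw [← h.quadRel_relExt]
  exact h.symmMax_relExt.mem_U c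


/-! ### Conjugation, scaling, addition and infimal convolution -/

/-- The inverse relation. -/
def relInv (S : Submodule ℝ (E n × E n)) : Submodule ℝ (E n × E n) :=
  S.comap (LinearEquiv.prodComm ℝ (E n) (E n)).toLinearMap

theorem mem_relInv {x u : E n} : (x, u) ∈ relInv S ↔ (u, x) ∈ S := Iff.rfl

theorem SymmMax.inv (h : SymmMax S) : SymmMax (relInv S) := by
  refine ⟨⟨?_, ?_⟩, ?_⟩
  · rintro ⟨x, u⟩ hp
    rw [real_inner_comm]
    exact h.nonneg _ (mem_relInv.1 hp)
  · rintro ⟨x, u⟩ hp ⟨y, w⟩ hq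
    exact (h.symm _ (mem_relInv.1 hp) _ (mem_relInv.1 hq)).symm
  · rintro ⟨x, u⟩ hp
    refine mem_relInv.2 (h.max _ ?_)
    rintro ⟨y, w⟩ hq
    rw [real_inner_comm]
    exact hp (w, y) (mem_relInv.2 hq)

/-- Both sides are suprema of the same affine functions, indexed by the graph; points outside the
domain contribute only `-∞` to the conjugate. -/
theorem SymmMax.fenchelConj_quadRel_add (h : SymmMax S) (c : ℝ) :
    fenchelConj (fun x => quadRel (S : Set (E n × E n)) x + (c : EReal)) =
      fun y => quadRel (relInv S : Set (E n × E n)) y + ((-c : ℝ) : EReal) := by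
  funext y
  rw [h.inv.quadRel_add_eq_iSup]
  apply le_antisymm
  · refine iSup_le fun x => ?_
    by_cases hx : ∃ u, (x, u) ∈ S
    · obtain ⟨u, hu⟩ := hx
      simp only
      rw [h.quadRel_of_mem hu, ← EReal.coe_add, ← EReal.coe_sub]
      refine le_iSup_of_le (⟨(u, x), hu⟩ : relInv S) (EReal.coe_le_coe_iff.2 ?_)
      simp only
      rw [real_inner_comm x y, real_inner_comm x u]
      linarith
    · push Not at hx
      simp only
      rw [quadRel_of_forall_notMem hx, EReal.top_add_coe, EReal.sub_top]
      exact bot_le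
  · refine iSup_le ?_
    rintro ⟨⟨u, x⟩, hp⟩
    refine le_iSup_of_le x ?_
    simp only
    rw [h.quadRel_of_mem (mem_relInv.1 hp), ← EReal.coe_add, ← EReal.coe_sub]
    refine EReal.coe_le_coe_iff.2 ?_
    rw [real_inner_comm x y, real_inner_comm x u]
    linarith

theorem fenchelConj_mem_U {f : E n → EReal} (hf : f ∈ U n) : fenchelConj f ∈ U n := by
  obtain ⟨S, c, hS, rfl⟩ := mem_U_iff.1 hf
  rw [hS.fenchelConj_quadRel_add]
  exact hS.inv.mem_U _

/-- The relation `l • A`. -/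
def relSmul (l : ℝ) (S : Submodule ℝ (E n × E n)) : Submodule ℝ (E n × E n) :=
  S.map (LinearMap.prodMap LinearMap.id (l • LinearMap.id))

theorem mem_relSmul {l : ℝ} {p : E n × E n} :
    p ∈ relSmul l S ↔ ∃ q ∈ S, (q.1, l • q.2) = p := Iff.rfl

theorem SymmMono.smul (h : SymmMono S) {l : ℝ} (hl : 0 ≤ l) : SymmMono (relSmul l S) := by
  refine ⟨?_, ?_⟩
  · rintro _ ⟨q, hq, rfl⟩
    simpa [real_inner_smul_right] using mul_nonneg hl (h.nonneg q hq)
  · rintro _ ⟨q, hq, rfl⟩ _ ⟨q', hq', rfl⟩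
    simp [real_inner_smul_right, real_inner_smul_left, h.symm q hq q' hq']

theorem smul_mem_U {f : E n → EReal} (hf : f ∈ U n) {l : ℝ} (hl : 0 < l) :
    (fun x => (l : EReal) * f x) ∈ U n := by
  obtain ⟨S, c, hS, rfl⟩ := mem_U_iff.1 hf
  convert (hS.toSymmMono.smul hl.le).mem_U (l * c) using 2 with x
  by_cases hx : ∃ u, (x, u) ∈ S
  · obtain ⟨u, hu⟩ := hx
    simp only
    rw [hS.quadRel_of_mem hu, (hS.toSymmMono.smul hl.le).quadRel_of_mem
      (mem_relSmul.2 ⟨_, hu, rfl⟩), ← EReal.coe_add, ← EReal.coe_mul, ← EReal.coe_add]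
    congr 1
    simp only [real_inner_smul_right]
    ring
  · push Not at hx
    have hx' : ∀ u, (x, u) ∉ relSmul l S := by
      rintro u ⟨q, hq, he⟩
      obtain rfl : q.1 = x := congrArg Prod.fst he
      exact hx _ hq
    simp only
    rw [quadRel_of_forall_notMem hx, quadRel_of_forall_notMem hx', EReal.top_add_coe,
      EReal.top_add_coe, EReal.coe_mul_top_of_pos hl]

/-- The sum of two relations. -/
def relSum (S T : Submodule ℝ (E n × E n)) : Submodule ℝ (E n × E n) where
  carrier := {p | ∃ u, (p.1, u) ∈ S ∧ (p.1, p.2 - u) ∈ T}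
  add_mem' := by
    rintro p q ⟨u, hu, hu'⟩ ⟨w, hw, hw'⟩
    refine ⟨u + w, S.add_mem hu hw, ?_⟩
    convert T.add_mem hu' hw' using 1
    ext1
    · rfl
    · simp only [Prod.snd_add]
      abel
  zero_mem' := ⟨0, S.zero_mem, by
    rw [Prod.snd_zero, sub_zero]
    exact T.zero_mem⟩
  smul_mem' := by
    rintro c p ⟨u, hu, hu'⟩
    refine ⟨c • u, S.smul_mem c hu, ?_⟩
    convert T.smul_mem c hu' using 1
    ext1
    · rfl
    · simp only [Prod.smul_snd, smul_sub]

theorem SymmMono.add (hS : SymmMono S) (hT : SymmMono T) : SymmMono (relSum S T) := by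
  refine ⟨?_, ?_⟩
  · rintro p ⟨u, hu, hu'⟩
    have h1 := hS.nonneg _ hu
    have h2 := hT.nonneg _ hu'
    simp only [inner_sub_right] at h1 h2
    linarith
  · rintro p ⟨u, hu, hu'⟩ q ⟨w, hw, hw'⟩
    have h1 := hS.symm _ hu _ hw
    have h2 := hT.symm _ hu' _ hw'
    simp only [inner_sub_right, inner_sub_left] at h1 h2
    linarith

theorem relDom_relSum : relDom (relSum S T) = relDom S ⊓ relDom T := by
  ext x
  rw [Submodule.mem_inf, mem_relDom, mem_relDom, mem_relDom]
  constructor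
  · rintro ⟨u, w, hw, hw'⟩
    exact ⟨⟨w, hw⟩, _, hw'⟩
  · rintro ⟨⟨u, hu⟩, w, hw⟩
    exact ⟨u + w, u, hu, by simpa using hw⟩

theorem orthogonal_inf (K L : Submodule ℝ (E n)) : (K ⊓ L)ᗮ = Kᗮ ⊔ Lᗮ := by
  rw [← Submodule.orthogonal_orthogonal (Kᗮ ⊔ Lᗮ), ← Submodule.inf_orthogonal,
    Submodule.orthogonal_orthogonal, Submodule.orthogonal_orthogonal]

/-- The extension adds nothing: two of its values at one point differ by a vector of `(dom S ∩ dom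
T)ᗮ = (dom S)ᗮ + (dom T)ᗮ`, and each summand is already a value at `0` of `S` or `T`. -/
theorem SymmMax.add (hS : SymmMax S) (hT : SymmMax T) : SymmMax (relSum S T) := by
  have hm := hS.toSymmMono.add hT.toSymmMono
  suffices h : relExt (relSum S T) = relSum S T from h ▸ hm.symmMax_relExt
  refine le_antisymm ?_ hm.le_relExt
  rintro ⟨x, u⟩ ⟨hx, hu⟩
  obtain ⟨w, hw⟩ := mem_relDom.1 hx
  have hperp : u - w ∈ (relDom (relSum S T))ᗮ := by
    refine (Submodule.mem_orthogonal _ _).2 fun a ha => ?_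
    obtain ⟨b, hb⟩ := mem_relDom.1 ha
    have h1 := hu _ hb
    have h2 := hm.symm _ hb _ hw
    simp only at h1 h2
    rw [inner_sub_right, h1, h2, sub_self]
  rw [relDom_relSum, orthogonal_inf] at hperp
  obtain ⟨a, ha, b, hb, hab⟩ := Submodule.mem_sup.1 hperp
  have h1 : ((0, u - w) : E n × E n) ∈ relSum S T :=
    ⟨a, hS.zero_prod_mem ha, by simpa [← hab] using hT.zero_prod_mem hb⟩
  simpa using Submodule.add_mem _ hw h1

theorem add_mem_U {f g : E n → EReal} (hf : f ∈ U n) (hg : g ∈ U n) :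
    (fun x => f x + g x) ∈ U n := by
  obtain ⟨S, c, hS, rfl⟩ := mem_U_iff.1 hf
  obtain ⟨T, d, hT, rfl⟩ := mem_U_iff.1 hg
  have hm := hS.add hT
  convert hm.mem_U (c + d) using 2 with x
  rw [EReal.coe_add, add_add_add_comm]
  congr 1
  by_cases hx : ∃ u, (x, u) ∈ relSum S T
  · obtain ⟨u, hu⟩ := hx
    obtain ⟨w, hw, hw'⟩ := hu
    rw [hm.quadRel_of_mem ⟨w, hw, hw'⟩, hS.quadRel_of_mem hw, hT.quadRel_of_mem hw',
      ← EReal.coe_add]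
    congr 1
    simp only [inner_sub_right]
    ring
  · rw [quadRel_of_forall_notMem fun u hu => hx ⟨u, hu⟩]
    rw [← mem_relDom, relDom_relSum, Submodule.mem_inf, not_and_or, mem_relDom, mem_relDom] at hx
    rcases hx with hx | hx
    · rw [quadRel_of_forall_notMem (A := (S : Set (E n × E n))) fun u hu => hx ⟨u, hu⟩,
        EReal.top_add_of_ne_bot (hT.quadRel_ne_bot x)]
    · rw [quadRel_of_forall_notMem (A := (T : Set (E n × E n))) fun u hu => hx ⟨u, hu⟩,
        EReal.add_top_of_ne_bot (hS.quadRel_ne_bot x)]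

/-- An isotropic vector of a positive semidefinite form lies in its radical: along `a + t y` the
form is affine in `t` and nonnegative. -/
theorem SymmMono.inner_eq_zero_of_inner_self (h : SymmMono S) {y v : E n} (hy : (y, v) ∈ S)
    (h0 : (inner ℝ y v : ℝ) = 0) {a : E n} (ha : a ∈ relDom S) : (inner ℝ v a : ℝ) = 0 := by
  obtain ⟨b, hb⟩ := mem_relDom.1 ha
  suffices 2 * (inner ℝ v a : ℝ) = 0 by linarith
  refine eq_zero_of_forall_add_mul_nonneg (a := inner ℝ a b) fun t => ?_
  have h1 := h.nonneg _ (S.add_mem hb (S.smul_mem t hy))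
  have h2 := h.symm _ hy _ hb
  simp only [Prod.smul_mk, Prod.mk_add_mk, inner_add_left, inner_add_right, real_inner_smul_left,
    real_inner_smul_right, h0, mul_zero] at h1 h2
  rw [h2, real_inner_comm v a] at h1
  linarith

/-- The parallel sum of two relations. -/
def relPar (S T : Submodule ℝ (E n × E n)) : Submodule ℝ (E n × E n) :=
  relInv (relSum (relInv S) (relInv T))

theorem mem_relPar {x u : E n} : (x, u) ∈ relPar S T ↔ ∃ y, (y, u) ∈ S ∧ (x - y, u) ∈ T := Iff.rfl

theorem SymmMax.infConv_quadRel_add (hS : SymmMax S) (hT : SymmMax T) (c d : ℝ) :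
    infConv (fun x => quadRel (S : Set (E n × E n)) x + (c : EReal))
      (fun x => quadRel (T : Set (E n × E n)) x + (d : EReal)) =
      fun x => quadRel (relPar S T : Set (E n × E n)) x + ((c + d : ℝ) : EReal) := by
  have hP : SymmMax (relPar S T) := (hS.inv.add hT.inv).inv
  funext x
  by_cases hx : ∃ u, (x, u) ∈ relPar S T
  · obtain ⟨u, hu⟩ := hx
    obtain ⟨y, hy, hy'⟩ := mem_relPar.1 hu
    rw [hP.quadRel_of_mem hu, ← EReal.coe_add]
    apply le_antisymm
    · refine iInf_le_of_le y ?_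
      simp only [hS.quadRel_of_mem hy, hT.quadRel_of_mem hy', ← EReal.coe_add,
        EReal.coe_le_coe_iff, inner_sub_left]
      linarith
    -- `S` at `y` and `T` at `x - y` share the slope `u`, so in the sum of the two affine minorants
    -- `z` cancels.
    · refine le_iInf fun z => ?_
      refine le_trans ?_ (add_le_add (add_le_add (hS.affine_le_quadRel hy z) le_rfl)
        (add_le_add (hT.affine_le_quadRel hy' (x - z)) le_rfl))
      simp only [← EReal.coe_add, EReal.coe_le_coe_iff, inner_sub_left, inner_sub_right]
      rw [real_inner_comm u x]
      linarith
  · rw [quadRel_of_forall_notMem fun u hu => hx ⟨u, hu⟩, EReal.top_add_coe]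
    refine iInf_eq_top.2 fun y => ?_
    -- Here `dom S + dom T ⊆ dom (relPar S T)` is used. If `v` is orthogonal to the latter, then
    -- `(a, v) ∈ S` and `(-a, v) ∈ T` for some `a`; both forms are nonnegative and opposite, hence
    -- zero, so `v` is orthogonal to both domains.
    have hne : ¬ (y ∈ relDom S ∧ x - y ∈ relDom T) := by
      rintro ⟨hy, hy'⟩
      refine hx (mem_relDom.1 (mem_of_forall_orthogonal _ fun v hv => ?_))
      obtain ⟨a, ha, ha'⟩ := mem_relPar.1 (hP.zero_prod_mem hv)
      have h1 := hS.nonneg _ ha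
      have h2 := hT.nonneg _ ha'
      simp only [zero_sub, inner_neg_left] at h1 h2
      have h3 := hS.inner_eq_zero_of_inner_self ha (by linarith) hy
      have h4 := hT.inner_eq_zero_of_inner_self ha'
        (by rw [zero_sub, inner_neg_left]; linarith) hy'
      rw [inner_sub_right] at h4
      linarith
    have b1 : quadRel (S : Set (E n × E n)) y + (c : EReal) ≠ ⊥ := by
      simp [EReal.add_eq_bot_iff, hS.quadRel_ne_bot]
    have b2 : quadRel (T : Set (E n × E n)) (x - y) + (d : EReal) ≠ ⊥ := by
      simp [EReal.add_eq_bot_iff, hT.quadRel_ne_bot]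
    rcases not_and_or.1 hne with hy | hy
    · simp only
      rw [quadRel_of_forall_notMem (A := (S : Set (E n × E n))) fun u hu =>
        hy (mem_relDom.2 ⟨u, hu⟩), EReal.top_add_coe, EReal.top_add_of_ne_bot b2]
    · simp only
      rw [quadRel_of_forall_notMem (A := (T : Set (E n × E n))) fun u hu =>
        hy (mem_relDom.2 ⟨u, hu⟩), EReal.top_add_coe, EReal.add_top_of_ne_bot b1]

theorem infConv_mem_U {f g : E n → EReal} (hf : f ∈ U n) (hg : g ∈ U n) :
    infConv f g ∈ U n := by
  obtain ⟨S, c, hS, rfl⟩ := mem_U_iff.1 hf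
  obtain ⟨T, d, hT, rfl⟩ := mem_U_iff.1 hg
  rw [hS.infConv_quadRel_add hT]
  exact (hS.inv.add hT.inv).inv.mem_U _


/-! ### Moreau envelopes and the operators that represent them -/

/-- Minty's surjectivity, by linear algebra: if `w` is orthogonal to the range, `(w, r w)` is
monotonically related to `S`, hence lies in it, and then `2 ⟨w, w⟩ = 0`. -/
theorem SymmMax.exists_resolvent (h : SymmMax S) (hr : 0 < r) (x : E n) :
    ∃ p ∈ S, p.1 + r⁻¹ • p.2 = x := by
  let L : E n × E n →ₗ[ℝ] E n := LinearMap.fst ℝ _ _ + r⁻¹ • LinearMap.snd ℝ _ _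
  suffices hx : x ∈ S.map L from hx
  refine mem_of_forall_orthogonal _ fun w hw => ?_
  have hL : ∀ q ∈ S, (inner ℝ w q.1 : ℝ) + r⁻¹ * inner ℝ w q.2 = 0 := by
    intro q hq
    have := (Submodule.mem_orthogonal' _ _).1 hw (L q) ⟨q, hq, rfl⟩
    simpa [L, inner_add_right, real_inner_smul_right] using this
  have hmem : (w, r • w) ∈ S := by
    refine h.max _ fun q hq => ?_
    have h1 := hL q hq
    have h2 := h.nonneg q hq
    have h3 : (inner ℝ (r • w - q.2) (w - q.1) : ℝ) =
        r * inner ℝ w w + inner ℝ q.1 q.2 - r * (inner ℝ w q.1 + r⁻¹ * inner ℝ w q.2) := by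
      simp only [inner_sub_left, inner_sub_right, real_inner_smul_left]
      rw [real_inner_comm w q.2, real_inner_comm q.1 q.2]
      field_simp
      ring
    rw [h3, h1, mul_zero, sub_zero]
    exact add_nonneg (mul_nonneg hr.le real_inner_self_nonneg) h2
  have h4 := hL _ hmem
  rw [real_inner_smul_right, inv_mul_cancel_left₀ hr.ne'] at h4
  have : w = 0 := inner_self_eq_zero (𝕜 := ℝ).1 (by linarith)
  rw [this, inner_zero_left]

/-- The infimum is attained at `p.1`: the affine minorant of slope `p.2`, exact there, plus the
penalty is a constant plus `r / 2 * ‖y - p.1‖ ^ 2`. -/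
theorem SymmMax.moreauEnv_quadRel_add (h : SymmMax S) (hr : 0 < r) (c : ℝ) {p : E n × E n}
    (hp : p ∈ S) :
    moreauEnv r (fun x => quadRel (S : Set (E n × E n)) x + (c : EReal)) (p.1 + r⁻¹ • p.2) =
      ((1 / 2 * inner ℝ (p.1 + r⁻¹ • p.2) p.2 + c : ℝ) : EReal) := by
  have hnorm : ∀ y : E n, r / 2 * ‖y - (p.1 + r⁻¹ • p.2)‖ ^ 2 =
      r / 2 * ‖y - p.1‖ ^ 2 - inner ℝ p.2 (y - p.1) + 1 / 2 * r⁻¹ * inner ℝ p.2 p.2 := by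
    intro y
    rw [← sub_sub, norm_sub_sq_real, real_inner_smul_right, norm_smul, mul_pow, Real.norm_eq_abs,
      sq_abs, real_inner_self_eq_norm_sq, real_inner_comm]
    field_simp
  apply le_antisymm
  · refine iInf_le_of_le p.1 ?_
    simp only [h.quadRel_of_mem (show (p.1, p.2) ∈ S from hp), ← EReal.coe_add,
      EReal.coe_le_coe_iff]
    rw [hnorm, inner_add_left, real_inner_smul_left]
    simp only [sub_self, inner_zero_right, norm_zero]
    linarith
  · refine le_iInf fun y => ?_
    refine le_trans ?_ (add_le_add (add_le_add (h.affine_le_quadRel hp y) le_rfl) le_rfl)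
    simp only [← EReal.coe_add, EReal.coe_le_coe_iff]
    rw [hnorm, inner_add_left, real_inner_smul_left, inner_sub_right, real_inner_comm p.1 p.2]
    have : 0 ≤ r / 2 * ‖y - p.1‖ ^ 2 := by positivity
    linarith

/-- The operators `M` for which `x ↦ ½ ⟨x, M x⟩` is the Moreau envelope with parameter `r` of a
generalized linear-quadratic function. -/
structure IsEnvOp (r : ℝ) (M : E n →L[ℝ] E n) : Prop where
  symm : ∀ x y, (inner ℝ (M x) y : ℝ) = inner ℝ x (M y)
  nonneg : ∀ x, 0 ≤ (inner ℝ (x - r⁻¹ • M x) (M x) : ℝ)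

/-- The relation whose envelope operator is `M`. -/
noncomputable def envRel (r : ℝ) (M : E n →L[ℝ] E n) : Submodule ℝ (E n × E n) :=
  LinearMap.range (LinearMap.prod (LinearMap.id - r⁻¹ • M.toLinearMap) M.toLinearMap)

theorem mem_envRel {M : E n →L[ℝ] E n} {p : E n × E n} :
    p ∈ envRel r M ↔ ∃ x, (x - r⁻¹ • M x, M x) = p := Iff.rfl

/-- The function `q_A + c` whose Moreau envelope is `x ↦ ½ ⟨x, M x⟩ + c`. -/
noncomputable def envFun (r : ℝ) (M : E n →L[ℝ] E n) (c : ℝ) : E n → EReal :=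
  fun x => quadRel (envRel r M : Set (E n × E n)) x + (c : EReal)

variable {M N : E n →L[ℝ] E n}

theorem IsEnvOp.symmMono (h : IsEnvOp r M) : SymmMono (envRel r M) := by
  refine ⟨?_, ?_⟩
  · rintro _ ⟨x, rfl⟩
    exact h.nonneg x
  · rintro _ ⟨x, rfl⟩ _ ⟨y, rfl⟩
    simp [inner_sub_left, inner_sub_right, real_inner_smul_left, real_inner_smul_right, h.symm]

theorem IsEnvOp.envFun_mem_U (h : IsEnvOp r M) (c : ℝ) : envFun r M c ∈ U n :=
  h.symmMono.mem_U c

theorem IsEnvOp.moreauEnv_envFun (h : IsEnvOp r M) (hr : 0 < r) (c : ℝ) (x : E n) :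
    moreauEnv r (envFun r M c) x = ((1 / 2 * inner ℝ x (M x) + c : ℝ) : EReal) := by
  -- Maximality of `envRel r M` is not needed: its extension has the same quadratic function and
  -- contains the pairs `(x - r⁻¹ M x, M x)`.
  have := h.symmMono.symmMax_relExt.moreauEnv_quadRel_add hr c
    (h.symmMono.le_relExt (mem_envRel.2 ⟨x, rfl⟩))
  simp only [h.symmMono.quadRel_relExt, sub_add_cancel] at this
  exact this

theorem exists_eq_envFun {f : E n → EReal} (hf : f ∈ U n) (hr : 0 < r) :
    ∃ (M : E n →L[ℝ] E n) (c : ℝ), IsEnvOp r M ∧ f = envFun r M c := by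
  obtain ⟨S, c, hS, rfl⟩ := mem_U_iff.1 hf
  let L : S →ₗ[ℝ] E n := (LinearMap.fst ℝ _ _ + r⁻¹ • LinearMap.snd ℝ _ _) ∘ₗ S.subtype
  have hL : Function.Bijective L := by
    constructor
    · rw [← LinearMap.ker_eq_bot, LinearMap.ker_eq_bot']
      intro p hp
      have hp : p.1.1 + r⁻¹ • p.1.2 = 0 := hp
      have h1 := hS.nonneg _ p.2
      rw [eq_neg_of_add_eq_zero_left hp, inner_neg_left, real_inner_smul_left] at h1
      have h2 : (inner ℝ p.1.2 p.1.2 : ℝ) = 0 := by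
        refine le_antisymm ?_ real_inner_self_nonneg
        have : 0 < r⁻¹ := inv_pos.2 hr
        by_contra! h3
        nlinarith [mul_pos this h3]
      have h3 : p.1.2 = 0 := inner_self_eq_zero (𝕜 := ℝ).1 h2
      rw [h3, smul_zero, add_zero] at hp
      exact Subtype.ext (Prod.ext hp h3)
    · intro x
      obtain ⟨p, hp, hpx⟩ := hS.exists_resolvent hr x
      exact ⟨⟨p, hp⟩, hpx⟩
  let e := LinearEquiv.ofBijective L hL
  -- `M` is the Yosida approximation: the second component of the inverse of `L`.
  let M : E n →L[ℝ] E n :=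
    LinearMap.toContinuousLinearMap (LinearMap.snd ℝ _ _ ∘ₗ S.subtype ∘ₗ e.symm.toLinearMap)
  have hM : ∀ x, M x = (e.symm x).1.2 := fun x => rfl
  have hM' : ∀ x, x - r⁻¹ • M x = (e.symm x).1.1 := fun x => by
    have : (e.symm x).1.1 + r⁻¹ • (e.symm x).1.2 = x := e.apply_symm_apply x
    rw [hM]
    nth_rewrite 1 [← this]
    rw [add_sub_cancel_right]
  have hmem : ∀ x, (x - r⁻¹ • M x, M x) ∈ S := fun x => by
    rw [hM', hM]
    exact (e.symm x).2
  have hSM : S = envRel r M := by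
    ext p
    constructor
    · intro hp
      refine ⟨e ⟨p, hp⟩, ?_⟩
      change (e ⟨p, hp⟩ - r⁻¹ • M (e ⟨p, hp⟩), M (e ⟨p, hp⟩)) = p
      rw [hM', hM, e.symm_apply_apply]
    · rintro ⟨x, rfl⟩
      exact hmem x
  refine ⟨M, c, ⟨fun x y => ?_, fun x => hS.nonneg _ (hmem x)⟩, by rw [hSM]; rfl⟩
  have := hS.symm _ (hmem x) _ (hmem y)
  simp only [inner_sub_left, inner_sub_right, real_inner_smul_left, real_inner_smul_right] at this
  linarith

theorem isClosed_setOf_isEnvOp (n : ℕ) (r : ℝ) :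
    IsClosed {M : E n →L[ℝ] E n | IsEnvOp r M} := by
  have : {M : E n →L[ℝ] E n | IsEnvOp r M} =
      (⋂ x, ⋂ y, {M | (inner ℝ (M x) y : ℝ) = inner ℝ x (M y)}) ∩
        ⋂ x, {M | 0 ≤ (inner ℝ (x - r⁻¹ • M x) (M x) : ℝ)} := by
    ext M
    simp only [Set.mem_inter_iff, Set.mem_iInter, Set.mem_ofPred_eq]
    exact ⟨fun h => ⟨h.symm, h.nonneg⟩, fun h => ⟨h.1, h.2⟩⟩
  rw [this]
  refine IsClosed.inter (isClosed_iInter fun x => isClosed_iInter fun y =>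
    isClosed_eq (by fun_prop) (by fun_prop)) (isClosed_iInter fun x =>
    isClosed_le (by fun_prop) (by fun_prop))


/-! ### The Attouch–Wets distance on `U` -/

section Gap

variable {c d : ℝ}

theorem IsEnvOp.envGap_eq (hM : IsEnvOp r M) (hN : IsEnvOp r N) (hr : 0 < r) (c d ρ : ℝ) :
    envGap r (envFun r M c) (envFun r N d) ρ =
      ⨆ x ∈ Metric.closedBall (0 : E n) ρ,
        ENNReal.ofReal |1 / 2 * inner ℝ x ((M - N) x) + (c - d)| := by
  unfold envGap
  refine iSup_congr fun x => iSup_congr fun _ => ?_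
  rw [hM.moreauEnv_envFun hr, hN.moreauEnv_envFun hr, ← EReal.coe_sub, EReal.abs_def]
  congr 2
  rw [sub_apply, inner_sub_right]
  ring

theorem IsEnvOp.envGap_le (hM : IsEnvOp r M) (hN : IsEnvOp r N) (hr : 0 < r) (c d ρ : ℝ) :
    envGap r (envFun r M c) (envFun r N d) ρ ≤
      ENNReal.ofReal (1 / 2 * ‖M - N‖ * ρ ^ 2 + |c - d|) := by
  rw [hM.envGap_eq hN hr]
  refine iSup₂_le fun x hx => ENNReal.ofReal_le_ofReal ?_
  have hx : ‖x‖ ≤ ρ := by simpa using hx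
  refine (abs_add_le _ _).trans (add_le_add ?_ le_rfl)
  have h1 : |(inner ℝ x ((M - N) x) : ℝ)| ≤ ‖M - N‖ * ρ ^ 2 :=
    calc |(inner ℝ x ((M - N) x) : ℝ)| ≤ ‖x‖ * ‖(M - N) x‖ := abs_real_inner_le_norm _ _
      _ ≤ ‖x‖ * (‖M - N‖ * ‖x‖) := by gcongr; exact ContinuousLinearMap.le_opNorm _ _
      _ = ‖M - N‖ * ‖x‖ ^ 2 := by ring
      _ ≤ ‖M - N‖ * ρ ^ 2 := by gcongr
  rw [abs_mul, abs_of_nonneg (by norm_num : (0 : ℝ) ≤ 1 / 2)]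
  linarith

theorem envGap_ne_top {f g : E n → EReal} (hf : f ∈ U n) (hg : g ∈ U n) (hr : 0 < r) (ρ : ℝ) :
    envGap r f g ρ ≠ ⊤ := by
  obtain ⟨M, c, hM, rfl⟩ := exists_eq_envFun hf hr
  obtain ⟨N, d, hN, rfl⟩ := exists_eq_envFun hg hr
  exact ne_top_of_le_ne_top ENNReal.ofReal_ne_top (hM.envGap_le hN hr c d ρ)

theorem IsEnvOp.abs_le_envGap (hM : IsEnvOp r M) (hN : IsEnvOp r N) (hr : 0 < r) (c d : ℝ)
    {x : E n} (hx : ‖x‖ ≤ ρ) : |1 / 2 * inner ℝ x ((M - N) x) + (c - d)| ≤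
      (envGap r (envFun r M c) (envFun r N d) ρ).toReal := by
  refine (ENNReal.ofReal_le_iff_le_toReal
    (envGap_ne_top (hM.envFun_mem_U c) (hN.envFun_mem_U d) hr ρ)).1 ?_
  rw [hM.envGap_eq hN hr]
  exact le_iSup₂ (f := fun x (_ : x ∈ Metric.closedBall (0 : E n) ρ) =>
    ENNReal.ofReal |1 / 2 * inner ℝ x ((M - N) x) + (c - d)|) x (by simpa using hx)

theorem IsEnvOp.toReal_envGap_le (hM : IsEnvOp r M) (hN : IsEnvOp r N) (hr : 0 < r)
    (c d ρ : ℝ) : (envGap r (envFun r M c) (envFun r N d) ρ).toReal ≤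
      1 / 2 * ‖M - N‖ * ρ ^ 2 + |c - d| :=
  ENNReal.toReal_le_of_le_ofReal (by positivity) (hM.envGap_le hN hr c d ρ)

theorem IsEnvOp.abs_sub_le_envGap (hM : IsEnvOp r M) (hN : IsEnvOp r N) (hr : 0 < r) (c d : ℝ)
    (hρ : 0 ≤ ρ) : |c - d| ≤ (envGap r (envFun r M c) (envFun r N d) ρ).toReal := by
  simpa using hM.abs_le_envGap hN hr c d (x := 0) (by simpa using hρ)

/-- Polarization at `x ± y`, with `x` a unit vector and `y` the direction of `T x`, isolates `4 ‖T
x‖` and cancels `c - d`. Radius 2 accommodates `x ± y`. -/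
theorem IsEnvOp.norm_sub_le_envGap (hM : IsEnvOp r M) (hN : IsEnvOp r N) (hr : 0 < r) (c d : ℝ) :
    ‖M - N‖ ≤ 2 * (envGap r (envFun r M c) (envFun r N d) 2).toReal := by
  have h0 := hM.abs_sub_le_envGap hN hr c d (ρ := 2) zero_le_two
  have hx := fun x (hx : ‖x‖ ≤ 2) => hM.abs_le_envGap hN hr c d hx
  set G := (envGap r (envFun r M c) (envFun r N d) 2).toReal
  set T := M - N with hT
  have hsymm : ∀ x y, (inner ℝ x (T y) : ℝ) = inner ℝ y (T x) := fun x y => by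
    simp only [hT, sub_apply, inner_sub_right]
    rw [← hM.symm, ← hN.symm, real_inner_comm y (M x), real_inner_comm y (N x)]
  refine ContinuousLinearMap.opNorm_le_of_unit_norm (by positivity) fun x hx1 => ?_
  rcases eq_or_ne (T x) 0 with h | h
  · rw [h, norm_zero]
    positivity
  · have hpos : 0 < ‖T x‖ := norm_pos_iff.2 h
    set y : E n := ‖T x‖⁻¹ • T x with hy
    have hy1 : ‖y‖ = 1 := norm_smul_inv_norm (𝕜 := ℝ) h
    have hyT : (inner ℝ y (T x) : ℝ) = ‖T x‖ := by
      rw [hy, real_inner_smul_left, real_inner_self_eq_norm_sq]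
      field_simp
    have h1 := hx (x + y) ((norm_add_le _ _).trans (by rw [hx1, hy1]; norm_num))
    have h2 := hx (x - y) ((norm_sub_le _ _).trans (by rw [hx1, hy1]; norm_num))
    have h3 : (inner ℝ (x + y) (T (x + y)) : ℝ) - inner ℝ (x - y) (T (x - y)) = 4 * ‖T x‖ := by
      simp only [map_add, map_sub, inner_add_left, inner_add_right, inner_sub_left,
        inner_sub_right]
      rw [hsymm x y, hyT]
      ring
    rw [abs_le] at h1 h2
    have hG : 0 ≤ G := (abs_nonneg _).trans h0
    linarith [h1.2, h2.1]

end Gap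

/-! ### Metric axioms for the gaps and the weighted series -/

theorem envGap_self {f : E n → EReal} (hf : f ∈ U n) (hr : 0 < r) (ρ : ℝ) :
    envGap r f f ρ = 0 := by
  obtain ⟨M, c, hM, rfl⟩ := exists_eq_envFun hf hr
  simp [hM.envGap_eq hM hr]

theorem envGap_comm {f g : E n → EReal} (hf : f ∈ U n) (hg : g ∈ U n) (hr : 0 < r) (ρ : ℝ) :
    envGap r f g ρ = envGap r g f ρ := by
  obtain ⟨M, c, hM, rfl⟩ := exists_eq_envFun hf hr
  obtain ⟨N, d, hN, rfl⟩ := exists_eq_envFun hg hr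
  rw [hM.envGap_eq hN hr, hN.envGap_eq hM hr]
  refine iSup_congr fun x => iSup_congr fun _ => ?_
  rw [← abs_neg, ← neg_sub M N, neg_apply, inner_neg_right]
  congr 2
  ring

theorem envGap_triangle {f g h : E n → EReal} (hf : f ∈ U n) (hg : g ∈ U n) (hh : h ∈ U n)
    (hr : 0 < r) (ρ : ℝ) : envGap r f h ρ ≤ envGap r f g ρ + envGap r g h ρ := by
  obtain ⟨M, c, hM, rfl⟩ := exists_eq_envFun hf hr
  obtain ⟨N, d, hN, rfl⟩ := exists_eq_envFun hg hr
  obtain ⟨P, e, hP, rfl⟩ := exists_eq_envFun hh hr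
  rw [hM.envGap_eq hP hr, hM.envGap_eq hN hr, hN.envGap_eq hP hr]
  refine iSup₂_le fun x hx => ?_
  refine le_trans ?_ (add_le_add
    (le_iSup₂ (f := fun x (_ : x ∈ Metric.closedBall (0 : E n) ρ) =>
      ENNReal.ofReal |1 / 2 * inner ℝ x ((M - N) x) + (c - d)|) x hx)
    (le_iSup₂ (f := fun x (_ : x ∈ Metric.closedBall (0 : E n) ρ) =>
      ENNReal.ofReal |1 / 2 * inner ℝ x ((N - P) x) + (d - e)|) x hx))
  rw [← ENNReal.ofReal_add (abs_nonneg _) (abs_nonneg _)]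
  refine ENNReal.ofReal_le_ofReal (le_trans (le_of_eq ?_) (abs_add_le _ _))
  congr 1
  simp only [sub_apply, inner_sub_right]
  ring

theorem eq_of_envGap_eq_zero {f g : E n → EReal} (hf : f ∈ U n) (hg : g ∈ U n) (hr : 0 < r)
    (h : envGap r f g 2 = 0) : f = g := by
  obtain ⟨M, c, hM, rfl⟩ := exists_eq_envFun hf hr
  obtain ⟨N, d, hN, rfl⟩ := exists_eq_envFun hg hr
  have h1 := hM.norm_sub_le_envGap hN hr c d
  have h2 := hM.abs_sub_le_envGap hN hr c d (ρ := 2) zero_le_two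
  rw [h, ENNReal.toReal_zero] at h1 h2
  rw [mul_zero, norm_le_zero_iff, sub_eq_zero] at h1
  rw [abs_nonpos_iff, sub_eq_zero] at h2
  rw [h1, h2]

theorem div_one_add_le_div_one_add {a b : ℝ} (ha : 0 ≤ a) (hab : a ≤ b) :
    a / (1 + a) ≤ b / (1 + b) := by
  rw [div_le_div_iff₀ (by linarith) (by linarith)]
  linarith

theorem add_div_one_add_le {a b : ℝ} (ha : 0 ≤ a) (hb : 0 ≤ b) :
    (a + b) / (1 + (a + b)) ≤ a / (1 + a) + b / (1 + b) := by
  rw [add_div]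
  gcongr <;> linarith

/-- The terms of the series defining the Attouch–Wets distance. -/
noncomputable def distTerm (r : ℝ) (f g : E n → EReal) (k : ℕ) : ℝ :=
  1 / (2 : ℝ) ^ (k + 1) *
    ((envGap r f g ((k : ℝ) + 1)).toReal / (1 + (envGap r f g ((k : ℝ) + 1)).toReal))

theorem distTerm_nonneg (f g : E n → EReal) (k : ℕ) : 0 ≤ distTerm r f g k := by
  unfold distTerm
  positivity

theorem distTerm_le (f g : E n → EReal) (k : ℕ) : distTerm r f g k ≤ 1 / (2 : ℝ) ^ (k + 1) := by
  refine mul_le_of_le_one_right (by positivity) (div_le_one_of_le₀ ?_ (by positivity))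
  linarith

theorem summable_one_div_two_pow_succ : Summable fun k : ℕ => 1 / (2 : ℝ) ^ (k + 1) := by
  have := (summable_nat_add_iff 1).2 summable_geometric_two
  simpa using this

theorem summable_distTerm (f g : E n → EReal) : Summable (distTerm r f g) :=
  Summable.of_nonneg_of_le (distTerm_nonneg f g) (distTerm_le f g) summable_one_div_two_pow_succ

theorem distTerm_le_attouchWetsDist (f g : E n → EReal) (k : ℕ) :
    distTerm r f g k ≤ attouchWetsDist r f g :=
  (summable_distTerm f g).le_tsum k fun _ _ => distTerm_nonneg f g _

theorem attouchWetsDist_triangle {f g h : E n → EReal} (hf : f ∈ U n) (hg : g ∈ U n)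
    (hh : h ∈ U n) (hr : 0 < r) :
    attouchWetsDist r f h ≤ attouchWetsDist r f g + attouchWetsDist r g h := by
  refine le_of_le_of_eq ((summable_distTerm f h).tsum_le_tsum (fun k => ?_)
    ((summable_distTerm f g).add (summable_distTerm g h)))
    ((summable_distTerm f g).tsum_add (summable_distTerm g h))
  unfold distTerm
  rw [← mul_add]
  refine mul_le_mul_of_nonneg_left ?_ (by positivity)
  refine le_trans (div_one_add_le_div_one_add ENNReal.toReal_nonneg ?_)
    (add_div_one_add_le ENNReal.toReal_nonneg ENNReal.toReal_nonneg)
  rw [← ENNReal.toReal_add (envGap_ne_top hf hg hr _) (envGap_ne_top hg hh hr _)]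
  exact ENNReal.toReal_mono (ENNReal.add_ne_top.2
    ⟨envGap_ne_top hf hg hr _, envGap_ne_top hg hh hr _⟩) (envGap_triangle hf hg hh hr _)

/-- A small distance controls the gap on the ball of radius `2`. -/
theorem envGap_two_le {f g : E n → EReal} (h : attouchWetsDist r f g ≤ 1 / 8) :
    (envGap r f g 2).toReal ≤ 8 * attouchWetsDist r f g := by
  -- Index 1 is the ball of radius 2, with weight `1 / 4`. From `G / (1 + G) ≤ 4 d` and `4 d ≤ 1 /
  -- 2` follows `G ≤ 8 d`.
  have h1 := distTerm_le_attouchWetsDist (r := r) f g 1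
  have h2 : distTerm r f g 1 =
      1 / 4 * ((envGap r f g 2).toReal / (1 + (envGap r f g 2).toReal)) := by
    unfold distTerm
    norm_num
  rw [h2] at h1
  set G := (envGap r f g 2).toReal
  have hG : 0 ≤ G := ENNReal.toReal_nonneg
  have h3 : G / (1 + G) ≤ 4 * attouchWetsDist r f g := by linarith
  rw [div_le_iff₀ (by linarith)] at h3
  nlinarith

theorem eq_of_attouchWetsDist_eq_zero {f g : E n → EReal} (hf : f ∈ U n) (hg : g ∈ U n)
    (hr : 0 < r) (h : attouchWetsDist r f g = 0) : f = g := by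
  have h1 := envGap_two_le (r := r) (f := f) (g := g) (by rw [h]; norm_num)
  rw [h, mul_zero] at h1
  refine eq_of_envGap_eq_zero hf hg hr ?_
  exact ((ENNReal.toReal_eq_zero_iff _).1 (le_antisymm h1 ENNReal.toReal_nonneg)).resolve_right
    (envGap_ne_top hf hg hr 2)

/-- The Attouch–Wets metric on `U`. -/
noncomputable abbrev attouchWetsMetric (n : ℕ) (hr : 0 < r) : MetricSpace (U n) where
  dist f g := attouchWetsDist r f.1 g.1
  dist_self f := by simp [attouchWetsDist, envGap_self f.2 hr]
  dist_comm f g := by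
    simp only [attouchWetsDist]
    refine tsum_congr fun k => ?_
    rw [envGap_comm f.2 g.2 hr]
  dist_triangle f g h := attouchWetsDist_triangle f.2 g.2 h.2 hr
  eq_of_dist_eq_zero {f g} h := Subtype.ext (eq_of_attouchWetsDist_eq_zero f.2 g.2 hr h)

/-! ### Convergence of codes and completeness -/

open Filter Topology in
theorem IsEnvOp.tendsto_attouchWetsDist {Ms : ℕ → E n →L[ℝ] E n} {cs : ℕ → ℝ}
    (hMs : ∀ k, IsEnvOp r (Ms k)) {M : E n →L[ℝ] E n} {c : ℝ} (hM : IsEnvOp r M) (hr : 0 < r)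
    (hMt : Tendsto Ms atTop (𝓝 M)) (hct : Tendsto cs atTop (𝓝 c)) :
    Tendsto (fun k => attouchWetsDist r (envFun r (Ms k) (cs k)) (envFun r M c)) atTop (𝓝 0) := by
  have hlim : Tendsto (fun k => ∑' i, distTerm r (envFun r (Ms k) (cs k)) (envFun r M c) i) atTop
      (𝓝 (∑' _ : ℕ, (0 : ℝ))) := by
    refine tendsto_tsum_of_dominated_convergence summable_one_div_two_pow_succ (fun i => ?_)
      (Eventually.of_forall fun k i => ?_)
    · have hb : Tendsto (fun k => 1 / 2 * ‖Ms k - M‖ * ((i : ℝ) + 1) ^ 2 + |cs k - c|) atTop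
          (𝓝 0) := by
        have h1 := tendsto_iff_norm_sub_tendsto_zero.1 hMt
        have h2 := tendsto_iff_norm_sub_tendsto_zero.1 hct
        have h3 := ((h1.const_mul (1 / 2)).mul_const (((i : ℝ) + 1) ^ 2)).add h2
        simp only [mul_zero, zero_mul, add_zero] at h3
        exact h3
      refine squeeze_zero (fun k => distTerm_nonneg _ _ _) (fun k => ?_) hb
      refine le_trans ?_ ((hMs k).toReal_envGap_le hM hr (cs k) c _)
      refine le_trans (mul_le_of_le_one_left (by positivity) ?_)
        (div_le_self ENNReal.toReal_nonneg (by simp))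
      exact div_le_one_of_le₀ (one_le_pow₀ one_le_two) (by positivity)
    · rw [Real.norm_of_nonneg (distTerm_nonneg _ _ _)]
      exact distTerm_le _ _ _
  simpa [attouchWetsDist, distTerm] using hlim

open Filter Topology in
theorem completeSpace_attouchWetsMetric (n : ℕ) (hr : 0 < r) :
    @CompleteSpace (U n) (attouchWetsMetric n hr).toUniformSpace := by
  let _ := attouchWetsMetric n hr
  have hdist : ∀ f g : U n, dist f g = attouchWetsDist r f.1 g.1 := fun _ _ => rfl
  refine Metric.complete_of_cauchySeq_tendsto fun u hu => ?_
  choose Ms cs hMs hu' using fun k => exists_eq_envFun (u k).2 hr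
  have key : ∀ ε > 0, ∃ K, ∀ k ≥ K, ∀ l ≥ K, ‖Ms k - Ms l‖ < ε ∧ |cs k - cs l| < ε := by
    intro ε hε
    -- `1 / 8` is the threshold of `envGap_two_le`; `16 = 2 * 8` combines its factor with that of
    -- `norm_sub_le_envGap`.
    obtain ⟨K, hK⟩ := Metric.cauchySeq_iff.1 hu (min (1 / 8) (ε / 16)) (by positivity)
    refine ⟨K, fun k hk l hl => ?_⟩
    have h1 := hK k hk l hl
    rw [lt_min_iff, hdist, hu' k, hu' l] at h1
    have h2 := envGap_two_le h1.1.le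
    have h3 := (hMs k).norm_sub_le_envGap (hMs l) hr (cs k) (cs l)
    have h4 := (hMs k).abs_sub_le_envGap (hMs l) hr (cs k) (cs l) (ρ := 2) zero_le_two
    constructor <;> linarith
  obtain ⟨M, hMt⟩ := cauchySeq_tendsto_of_complete (u := Ms) (Metric.cauchySeq_iff.2 fun ε hε =>
    (key ε hε).imp fun K hK k hk l hl => by rw [dist_eq_norm]; exact (hK k hk l hl).1)
  obtain ⟨c, hct⟩ := cauchySeq_tendsto_of_complete (u := cs) (Metric.cauchySeq_iff.2 fun ε hε =>
    (key ε hε).imp fun K hK k hk l hl => (hK k hk l hl).2)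
  have hM : IsEnvOp r M := (isClosed_setOf_isEnvOp n r).mem_of_tendsto hMt
    (Eventually.of_forall hMs)
  refine ⟨⟨envFun r M c, hM.envFun_mem_U c⟩, tendsto_iff_dist_tendsto_zero.2 ?_⟩
  simpa only [hdist, hu'] using IsEnvOp.tendsto_attouchWetsDist hMs hM hr hMt hct

end GenLinQuad

theorem mainTheorem8 (n : ℕ) :
    (∀ r : ℝ, 0 < r →
      (∀ f ∈ GenLinQuad.U n, ∀ g ∈ GenLinQuad.U n, ∀ ρ : ℝ, GenLinQuad.envGap r f g ρ ≠ ⊤) ∧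
      ∃ m : MetricSpace (GenLinQuad.U n),
        (∀ f g : GenLinQuad.U n, m.dist f g = GenLinQuad.attouchWetsDist r f.1 g.1) ∧
        @CompleteSpace (GenLinQuad.U n) m.toUniformSpace) ∧
    (∀ f ∈ GenLinQuad.U n, GenLinQuad.fenchelConj f ∈ GenLinQuad.U n) ∧
    (∀ f ∈ GenLinQuad.U n, ∀ l : ℝ, 0 < l →
      (fun x => (l : EReal) * f x) ∈ GenLinQuad.U n) ∧
    (∀ f₁ ∈ GenLinQuad.U n, ∀ f₂ ∈ GenLinQuad.U n,
      (fun x => f₁ x + f₂ x) ∈ GenLinQuad.U n) ∧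
    (∀ f₁ ∈ GenLinQuad.U n, ∀ f₂ ∈ GenLinQuad.U n,
      GenLinQuad.infConv f₁ f₂ ∈ GenLinQuad.U n) := by
  refine ⟨fun r hr => ⟨fun f hf g hg ρ => GenLinQuad.envGap_ne_top hf hg hr ρ,
    GenLinQuad.attouchWetsMetric n hr, fun _ _ => rfl,
    GenLinQuad.completeSpace_attouchWetsMetric n hr⟩,
    fun _ hf => GenLinQuad.fenchelConj_mem_U hf,
    fun _ hf _ hl => GenLinQuad.smul_mem_U hf hl,
    fun _ hf _ hg => GenLinQuad.add_mem_U hf hg,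
    fun _ hf _ hg => GenLinQuad.infConv_mem_U hf hg⟩
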